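/- **Proposition.** Let $k$ be a field, let $n\le N$ and $r$ be natural numbers, let $f_1,\dots,f_r\in k[x_1,\dots,x_N]$, and let $A=k[x_1,\dots,x_N]/(f_1,\dots,f_r)$. Suppose that $A$ is smooth over $k$ and that $\operatorname{Spec}A$ has pure dimension $n$, i.e. every irreducible component of $\operatorname{Spec}A$ has dimension $n$. Let $\mathrm{ROW}\subset\{1,\dots,r\}$ and $\mathrm{COL}\subset\{1,\dots,N\}$ be increasing $(N-n)$-tuples, let $$M=\Big(\frac{\partial f_i}{\partial x_j}\Big)_{i\in\mathrm{ROW},\,j\in\mathrm{COL}}$$ be the corresponding $(N-n)\times(N-n)$ submatrix of the Jacobian matrix, let $h=\det M$ (with $h=1$ if $N=n$), and let $C=(C_{ij})_{i\in\mathrm{ROW},\,j\in\mathrm{COL}}$ be the cofactor matrix of $M$, i.e. $C_{ij}$ is the signed minor of $M$ obtained by deleting row $i$ and column $j$, so that $C^{T}M=hI$. For each $j'\in\{1,\dots,N\}\setminus\mathrm{COL}$ consider $$D_{j'}=h\,\frac{\partial}{\partial x_{j'}}-\sum_{\substack{i\in\mathrm{ROW}\\ j\in\mathrm{COL}}}\frac{\partial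 f_i}{\partial x_{j'}}\,C_{ij}\,\frac{\partial}{\partial x_j}.$$ Then each $D_{j'}$, a derivation of $k[x_1,\dots,x_N]$, induces a unique $k$-derivation of $A[h^{-1}]$ (one compatible with the canonical map $k[x_1,\dots,x_N]\to A[h^{-1}]$), and the derivations $D_{j'}$, $j'\in\{1,\dots,N\}\setminus\mathrm{COL}$, so obtained form a basis of the $A[h^{-1}]$-module $\operatorname{Der}_k(A[h^{-1}],A[h^{-1}])$. -/

import Mathlib

/-- The Jacobian matrix `(∂ f i / ∂ x j)` of a finite family of polynomials,
with entries in the polynomial ring. -/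
noncomputable def polyJacobian {k : Type*} [Field k] {N r : ℕ}
    (f : Fin r → MvPolynomial (Fin N) k) :
    Matrix (Fin r) (Fin N) (MvPolynomial (Fin N) k) :=
  Matrix.of fun i j => MvPolynomial.pderiv j (f i)

/-- The square submatrix of the Jacobian with rows `row` and columns `col`,
two increasing `c`-tuples of indices. -/
noncomputable def jacobianSubmatrix {k : Type*} [Field k] {N r c : ℕ}
    (f : Fin r → MvPolynomial (Fin N) k) (row : Fin c ↪o Fin r) (col : Fin c ↪o Fin N) :
    Matrix (Fin c) (Fin c) (MvPolynomial (Fin N) k) :=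
  (polyJacobian f).submatrix row col

/-- The cofactor matrix, whose `(i, j)` entry is the signed minor obtained by deleting row `i` and
column `j`.  It is the transpose of the adjugate, so `Cᵀ * M = det M • 1`. -/
def cofactorMatrix {R : Type*} [CommRing R] {c : ℕ} (M : Matrix (Fin c) (Fin c) R) :
    Matrix (Fin c) (Fin c) R :=
  M.adjugate.transpose

/-- The entries of the cofactor matrix are the signed minors. -/
theorem cofactorMatrix_apply {R : Type*} [CommRing R] {c : ℕ}
    (M : Matrix (Fin (c + 1)) (Fin (c + 1)) R) (i j : Fin (c + 1)) :
    cofactorMatrix M i j =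
      (-1) ^ (i + j : ℕ) * (M.submatrix i.succAbove j.succAbove).det := by
  simp [cofactorMatrix, Matrix.adjugate_fin_succ_eq_det_submatrix]

/-- The derivation
`h ∂/∂x_{j'} - ∑_{i ∈ row, j ∈ col} (∂f_i/∂x_{j'}) C_{ij} ∂/∂x_j`
of the polynomial ring, where `h` and `C` are the determinant and the cofactor matrix of the
submatrix of the Jacobian of `f` given by `row` and `col`. -/
noncomputable def minorDerivation {k : Type*} [Field k] {N r c : ℕ}
    (f : Fin r → MvPolynomial (Fin N) k) (row : Fin c ↪o Fin r) (col : Fin c ↪o Fin N)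
    (j' : Fin N) : Derivation k (MvPolynomial (Fin N) k) (MvPolynomial (Fin N) k) :=
  (jacobianSubmatrix f row col).det • MvPolynomial.pderiv j' -
    ∑ i : Fin c, ∑ j : Fin c,
      (MvPolynomial.pderiv j' (f (row i)) * cofactorMatrix (jacobianSubmatrix f row col) i j) •
        MvPolynomial.pderiv (col j)

/-- `Spec A` has pure dimension `n`: every irreducible component of `Spec A`, that is the closed
subset defined by a minimal prime of `A`, has dimension `n`. -/
def IsPureDimensional (A : Type*) [CommRing A] (n : ℕ) : Prop :=
  ∀ p ∈ minimalPrimes A, ringKrullDim (A ⧸ p) = n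

/-- The coordinate ring `k[x_1, …, x_N] / (f_1, …, f_r)`. -/
abbrev CoordRing {k : Type*} [Field k] {N r : ℕ} (f : Fin r → MvPolynomial (Fin N) k) : Type _ :=
  MvPolynomial (Fin N) k ⧸ Ideal.span (Set.range f)

/-- The localization `A[h⁻¹]` of `A = k[x_1, …, x_N] / (f_1, …, f_r)` at the class of the
polynomial `h`. -/
abbrev CoordRingAway {k : Type*} [Field k] {N r : ℕ} (f : Fin r → MvPolynomial (Fin N) k)
    (h : MvPolynomial (Fin N) k) : Type _ :=
  Localization.Away (Ideal.Quotient.mk (Ideal.span (Set.range f)) h)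

/-- The canonical ring homomorphism `k[x_1, …, x_N] → A → A[h⁻¹]`. -/
noncomputable def toCoordRingAway {k : Type*} [Field k] {N r : ℕ}
    (f : Fin r → MvPolynomial (Fin N) k) (h : MvPolynomial (Fin N) k) :
    MvPolynomial (Fin N) k →+* CoordRingAway f h :=
  (algebraMap (CoordRing f) (CoordRingAway f h)).comp
    (Ideal.Quotient.mk (Ideal.span (Set.range f)))

/-! Write B = A[h⁻¹]. Multiplying the relations df_i = 0 by the cofactors of M expresses each
h·dx_j, j ∈ COL, through the dx_{j'} with j' ∉ COL (`det_smul_derivation_apply`). As h is a unit in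
B, these n differentials generate Ω_{B/k}. They are independent: at a minimal prime p of B, let K =
Frac(B/p). Then n ≤ trdeg K ≤ dim Ω_{K/k}, so the n generators become a basis of Ω_{K/k} and the
coefficients of any relation over B lie in p. Over all p, the coefficients are nilpotent; since
Ω_{B/k} is projective by smoothness, Nakayama kills the relations (`linearIndependent_D`).
Reducedness of B is never needed. Cramer's rule applied to the dual basis δ_{j'} shows that D_{j'}
induces h·δ_{j'}, a unit rescaling of a basis. -/

/-! ### Transcendence degree, differentials and Krull dimension -/

open KaehlerDifferential in
/-- The transcendence degree of a finitely generated field extension is at most the number of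
elements whose differentials generate the module of differentials. -/
theorem trdeg_le_mk_of_span_D_image_eq_top {k K : Type*} [Field k] [Field K] [Algebra k K]
    [Algebra.EssFiniteType k K] (s : Set K)
    (hs : Submodule.span K (D k K '' s) = ⊤) : Algebra.trdeg k K ≤ Cardinal.mk s := by
  let L := IntermediateField.adjoin k s
  -- Ω_{K/L} is a quotient of Ω_{K/k}, and the generators dx, x ∈ s, die in it because x ∈ L. An
  -- unramified, essentially finite extension of fields is finite, hence algebraic; this holds in
  -- every characteristic.
  have : Algebra.FormallyUnramified L K := by
    refine ⟨?_⟩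
    rw [← Submodule.subsingleton_iff K, ← subsingleton_iff_bot_eq_top, eq_comm,
      ← LinearMap.range_eq_top.mpr (map_surjective k L K), LinearMap.range_eq_map, ← hs,
      Submodule.map_span, Submodule.span_eq_bot]
    rintro _ ⟨_, ⟨x, hx, rfl⟩, rfl⟩
    rw [map_D]
    exact (D L K).map_algebraMap ⟨x, IntermediateField.subset_adjoin k s hx⟩
  have := Algebra.EssFiniteType.of_comp k L K
  have := Algebra.FormallyUnramified.finite_of_free L K
  have hL : Algebra.IsAlgebraic L K := inferInstance
  open scoped IntermediateField.algebraAdjoinAdjoin in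
  have : Algebra.IsAlgebraic (Algebra.adjoin k s) K :=
    (IsFractionRing.comap_isAlgebraic_iff (K := L)).mpr hL
  exact Algebra.IsAlgebraic.trdeg_le_cardinalMk k s

open KaehlerDifferential in
theorem trdeg_le_finrank_kaehlerDifferential (k K : Type*) [Field k] [Field K] [Algebra k K]
    [Algebra.EssFiniteType k K] :
    Algebra.trdeg k K ≤ Module.finrank K (KaehlerDifferential k K) := by
  obtain ⟨b, hb, hspan, hli⟩ := exists_linearIndependent K (Set.range (D k K))
  rw [span_range_derivation] at hspan
  obtain ⟨s, rfl, hinj⟩ := Set.exists_image_eq_injOn_of_subset_range hb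
  have h := trdeg_le_mk_of_span_D_image_eq_top s hspan
  have hb := (Module.Basis.mk hli (by simpa only [Subtype.range_coe] using hspan.ge)).mk_eq_rank''
  rwa [Module.finrank_eq_rank, ← hb, Cardinal.mk_image_eq_of_injOn _ _ hinj]

/-- The Krull dimension of a finitely generated algebra over a field is at most its transcendence
degree. -/
theorem le_trdeg_of_le_ringKrullDim (k S : Type*) [Field k] [CommRing S] [Nontrivial S]
    [Algebra k S] [Algebra.FiniteType k S] {n : ℕ} (hn : n ≤ ringKrullDim S) :
    (n : Cardinal) ≤ Algebra.trdeg k S := by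
  -- Noether normalization: `s` bounds the dimension from above by integrality, and the
  -- transcendence degree from below by injectivity.
  obtain ⟨s, g, hinj, hint⟩ := exists_integral_inj_algHom_of_fg k S
  have hs : ringKrullDim S ≤ s := by
    algebraize [g.toRingHom]
    have : Algebra.IsIntegral (MvPolynomial (Fin s) k) S := ⟨hint⟩
    calc ringKrullDim S ≤ ringKrullDim (MvPolynomial (Fin s) k) :=
          Order.krullDim_le_of_strictMono
            (PrimeSpectrum.comap (algebraMap (MvPolynomial (Fin s) k) S)) fun I J hIJ =>
              Ideal.IsIntegral.comap_lt_comap hIJ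
      _ = s := by simp [ringKrullDim_eq_zero_of_field]
  have hns : n ≤ s := by exact_mod_cast hn.trans hs
  have h := lift_trdeg_le_of_injective g hinj
  simp at h
  exact le_trans (by exact_mod_cast hns) h

/-! ### Linear independence of generating differentials -/

/-- A finite generating family of a projective module all of whose relations have nilpotent
coefficients is linearly independent. -/
theorem linearIndependent_of_mem_nilradical {R M ι : Type*} [CommRing R] [AddCommGroup M]
    [Module R M] [Module.Projective R M] [Fintype ι] {v : ι → M}
    (hv : Submodule.span R (Set.range v) = ⊤)
    (h : ∀ c : ι → R, ∑ i, c i • v i = 0 → ∀ i, c i ∈ nilradical R) :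
    LinearIndependent R v := by
  classical
  let ψ := Fintype.linearCombination R v
  have hψ : Function.Surjective ψ := by
    rw [← LinearMap.range_eq_top, Fintype.range_linearCombination, hv]
  obtain ⟨σ, hσ⟩ := Module.projective_lifting_property ψ LinearMap.id hψ
  -- The projection onto the relation module `ker ψ`, which is therefore finitely generated.
  let e : (ι → R) →ₗ[R] (ι → R) := LinearMap.id - σ ∘ₗ ψ
  have he (c) : e c ∈ LinearMap.ker ψ := by
    have := LinearMap.congr_fun hσ (ψ c)
    simp only [LinearMap.comp_apply, LinearMap.id_apply] at this
    simp [e, this]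
  have hc (c) (hc : c ∈ LinearMap.ker ψ) : e c = c := by
    simp [e, LinearMap.mem_ker.mp hc]
  have hfg : (LinearMap.ker ψ).FG := by
    have : LinearMap.ker ψ = LinearMap.range e :=
      le_antisymm (fun c hk => ⟨c, hc c hk⟩) (by rintro _ ⟨c, rfl⟩; exact he c)
    rw [this, LinearMap.range_eq_map]
    exact Module.Finite.fg_top.map e
  rw [linearIndependent_iff_injective_fintypeLinearCombination, ← LinearMap.ker_eq_bot]
  -- Nakayama: a relation c equals e(c) = ∑ c_i e(e_i), with c_i nilpotent and e(e_i) in the kernel.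
  refine Submodule.eq_bot_of_le_smul_of_le_jacobson_bot (nilradical R) _ hfg (fun c hk => ?_)
    Ideal.radical_le_jacobson
  rw [← hc c hk, pi_eq_sum_univ c, map_sum]
  refine Submodule.sum_mem _ fun i _ => ?_
  rw [map_smul]
  exact Submodule.smul_mem_smul (h c hk i) (he _)

open KaehlerDifferential in
/-- If `K` is a localization of a quotient `B` of `A`, then generators of the differentials of `A`
induce generators of the differentials of `K`. -/
theorem span_D_algebraMap_eq_top {k A B K ι : Type*} [CommRing k] [CommRing A] [CommRing B]
    [CommRing K] [Algebra k A] [Algebra k B] [Algebra k K] [Algebra A B] [Algebra B K] [Algebra A K]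
    [IsScalarTower k A B] [IsScalarTower k B K] [IsScalarTower k A K] [IsScalarTower A B K]
    (hAB : Function.Surjective (algebraMap A B)) (T : Submonoid B) [IsLocalization T K]
    {x : ι → A} (hx : Submodule.span A (Set.range fun i => D k A (x i)) = ⊤) :
    Submodule.span K (Set.range fun i => D k K (algebraMap A K (x i))) = ⊤ := by
  rw [eq_top_iff, ← span_range_map_derivation_of_isLocalization k B K T, Submodule.span_le]
  rintro _ ⟨b, rfl⟩
  obtain ⟨a, rfl⟩ := hAB b
  have key : map k k A K (D k A a) ∈
      (Submodule.span A (Set.range fun i => D k A (x i))).map (map k k A K) :=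
    Submodule.mem_map_of_mem (hx ▸ Submodule.mem_top)
  rw [Submodule.map_span, ← Set.range_comp, map_D] at key
  simp only [Function.comp_apply, map_D, ← IsScalarTower.algebraMap_apply, SetLike.mem_coe]
  refine Submodule.span_subset_span A K _ ?_
  simpa [Function.comp_def] using key

/-- Differentials generating a projective module of differentials are linearly independent if there
are at most as many of them as the transcendence degree of each irreducible component. -/
theorem linearIndependent_D {k B ι : Type*} [Field k] [CommRing B] [Algebra k B]
    [Algebra.EssFiniteType k B] [Module.Projective B (KaehlerDifferential k B)] [Fintype ι]
    {x : ι → B} (hx : Submodule.span B (Set.range fun i => KaehlerDifferential.D k B (x i)) = ⊤)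
    (hdim : ∀ p ∈ minimalPrimes B, (Fintype.card ι : Cardinal) ≤ Algebra.trdeg k (B ⧸ p)) :
    LinearIndependent B fun i => KaehlerDifferential.D k B (x i) := by
  refine linearIndependent_of_mem_nilradical hx fun c hc i => ?_
  rw [nilradical, ← Ideal.sInf_minimalPrimes, Submodule.mem_sInf]
  intro p hp
  have := hp.1.1
  let K := FractionRing (B ⧸ p)
  have hspan := span_D_algebraMap_eq_top (K := K) Ideal.Quotient.mk_surjective
    (nonZeroDivisors (B ⧸ p)) hx
  have hcard : Fintype.card ι = Module.finrank K (KaehlerDifferential k K) := by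
    refine le_antisymm ?_ ?_
    · have h1 := (hdim p hp).trans (trdeg_le_of_injective
        (IsScalarTower.toAlgHom k (B ⧸ p) K) (IsFractionRing.injective (B ⧸ p) K))
      exact_mod_cast h1.trans (trdeg_le_finrank_kaehlerDifferential k K)
    · exact finrank_le_of_span_eq_top hspan
  have hli := linearIndependent_of_top_le_span_of_card_eq_finrank hspan.ge hcard
  have h0 := congrArg (KaehlerDifferential.map k k B K) hc
  simp only [map_sum, map_smul, KaehlerDifferential.map_D, map_zero] at h0
  have := Fintype.linearIndependent_iff.mp hli (fun i => algebraMap B K (c i))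
    (by simpa [algebraMap_smul] using h0) i
  rw [IsScalarTower.algebraMap_apply B (B ⧸ p) K,
    FaithfulSMul.algebraMap_eq_zero_iff] at this
  exact Ideal.Quotient.eq_zero_iff_mem.mp this
-- Cramer's rule for derivations
open MvPolynomial

theorem Fintype.sum_eq_sum_add_sum_notMem_range {ι κ M : Type*} [Fintype ι] [Fintype κ]
    [AddCommMonoid M] (e : ι ↪ κ) [Fintype {j // j ∉ Set.range e}] (g : κ → M) :
    ∑ l, g l = ∑ i, g (e i) + ∑ j : {j // j ∉ Set.range e}, g j := by
  classical
  rw [← Fintype.sum_subtype_add_sum_subtype (· ∈ Set.range e)]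
  congr 1
  · convert! (Fintype.sum_equiv (Equiv.ofInjective e e.injective) (fun i => g (e i))
      (fun l => g l) fun _ => rfl).symm
  · convert! rfl

theorem Derivation.apply_algHom_mvPolynomial {k σ B M : Type*} [CommRing k] [Fintype σ]
    [CommRing B] [Algebra k B] [AddCommGroup M] [Module k M] [Module B M]
    (φ : MvPolynomial σ k →ₐ[k] B) (E : Derivation k B M) (p : MvPolynomial σ k) :
    E (φ p) = ∑ l, φ (pderiv l p) • E (φ (X l)) := by
  induction p using MvPolynomial.induction_on with
  | C a => rw [show φ (C a) = algebraMap k B a from φ.commutes a]; simp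
  | add p q hp hq => simp [hp, hq, add_smul, Finset.sum_add_distrib]
  | mul_X p i hp =>
    classical
    simp [hp, add_smul, mul_smul, Finset.sum_add_distrib, Finset.smul_sum, smul_comm (φ (X i)),
      pderiv_X, Pi.single_apply, apply_ite φ, ite_smul]

section minorDerivation

variable {k : Type*} [Field k] {N r c : ℕ} (f : Fin r → MvPolynomial (Fin N) k)
  (row : Fin c ↪o Fin r) (col : Fin c ↪o Fin N)

theorem minorDerivation_apply (j' : Fin N) (p : MvPolynomial (Fin N) k) :
    minorDerivation f row col j' p = (jacobianSubmatrix f row col).det * pderiv j' p -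
      ∑ i, ∑ j, pderiv j' (f (row i)) * cofactorMatrix (jacobianSubmatrix f row col) i j *
        pderiv (col j) p := by
  have hsum {ι : Type} [Fintype ι] (D : ι → Derivation k (MvPolynomial (Fin N) k)
      (MvPolynomial (Fin N) k)) : (∑ i, D i) p = ∑ i, D i p :=
    map_sum ((Pi.evalAddMonoidHom _ p).comp Derivation.coeFnAddMonoidHom) D Finset.univ
  simp [minorDerivation, hsum]

theorem minorDerivation_X_of_notMem {j' l : Fin N} (hl : l ∉ Set.range col) :
    minorDerivation f row col j' (X l) =
      if j' = l then (jacobianSubmatrix f row col).det else 0 := by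
  have h (j) : col j ≠ l := fun h => hl ⟨j, h⟩
  classical
  simp [minorDerivation_apply, pderiv_X, Pi.single_apply, h, eq_comm]

theorem minorDerivation_X_col {j' : Fin N} (hj' : j' ∉ Set.range col) (j : Fin c) :
    minorDerivation f row col j' (X (col j)) =
      -∑ i, cofactorMatrix (jacobianSubmatrix f row col) i j * pderiv j' (f (row i)) := by
  have h (j) : col j ≠ j' := fun h => hj' ⟨j, h⟩
  classical
  simp [minorDerivation_apply, pderiv_X, Pi.single_apply, h, mul_comm]

theorem sum_cofactorMatrix_mul_pderiv (j j₀ : Fin c) :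
    ∑ i, cofactorMatrix (jacobianSubmatrix f row col) i j * pderiv (col j₀) (f (row i)) =
      if j = j₀ then (jacobianSubmatrix f row col).det else 0 := by
  have := congrFun₂ (Matrix.adjugate_mul (jacobianSubmatrix f row col)) j j₀
  simpa [Matrix.mul_apply, Matrix.one_apply, cofactorMatrix, jacobianSubmatrix, polyJacobian]
    using this

variable {B M : Type*} [CommRing B] [Algebra k B] [AddCommGroup M] [Module k M] [Module B M]

/-- Cramer's rule for the values of a derivation at a point of the zero locus of the `f i`. -/
theorem det_smul_derivation_apply (φ : MvPolynomial (Fin N) k →ₐ[k] B)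
    (hφ : ∀ i, φ (f (row i)) = 0) (E : Derivation k B M) (p : MvPolynomial (Fin N) k) :
    φ (jacobianSubmatrix f row col).det • E (φ p) =
      ∑ j' : {j' : Fin N // j' ∉ Set.range col},
        φ (minorDerivation f row col j' p) • E (φ (X j')) := by
  classical
  have hX (l : Fin N) : φ (jacobianSubmatrix f row col).det • E (φ (X l)) =
      ∑ j' : {j' : Fin N // j' ∉ Set.range col},
        φ (minorDerivation f row col j' (X l)) • E (φ (X j')) := by
    by_cases hl : l ∈ Set.range col
    · obtain ⟨j, rfl⟩ := hl
      -- This is ∑_i C_{ij} E(φ(f_i)) = 0, expanded by the chain rule; among the columns in `col`,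
      -- only l = col j survives, with coefficient h.
      have h0 : ∑ l, φ (∑ i, cofactorMatrix (jacobianSubmatrix f row col) i j *
          pderiv l (f (row i))) • E (φ (X l)) = 0 := by
        simp_rw [map_sum, Finset.sum_smul, map_mul, mul_smul]
        rw [Finset.sum_comm]
        refine Finset.sum_eq_zero fun i _ => ?_
        rw [← Finset.smul_sum, ← Derivation.apply_algHom_mvPolynomial, hφ, map_zero, smul_zero]
      rw [Fintype.sum_eq_sum_add_sum_notMem_range col.toEmbedding] at h0
      simp only [RelEmbedding.coe_toEmbedding, sum_cofactorMatrix_mul_pderiv, apply_ite φ, map_zero,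
        ite_smul, zero_smul, Finset.sum_ite_eq, Finset.mem_univ, if_true] at h0
      rw [eq_neg_of_add_eq_zero_left h0, ← Finset.sum_neg_distrib]
      refine Finset.sum_congr rfl fun j' _ => ?_
      rw [minorDerivation_X_col f row col j'.2, map_neg, neg_smul]
    · simp_rw [minorDerivation_X_of_notMem f row col hl, apply_ite φ, map_zero, ite_smul, zero_smul]
      rw [Finset.sum_eq_single ⟨l, hl⟩] <;> simp +contextual [Subtype.ext_iff]
  have hD (j' : Fin N) : minorDerivation f row col j' p =
      ∑ l, pderiv l p * minorDerivation f row col j' (X l) := by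
    simpa using (minorDerivation f row col j').apply_algHom_mvPolynomial (AlgHom.id k _) p
  simp_rw [hD, map_sum, Finset.sum_smul, map_mul, mul_smul]
  rw [Finset.sum_comm, Derivation.apply_algHom_mvPolynomial φ E p, Finset.smul_sum]
  refine Finset.sum_congr rfl fun l _ => ?_
  rw [smul_comm, hX, Finset.smul_sum]

end minorDerivation
-- Generators of Ω and the basis of derivations
open MvPolynomial KaehlerDifferential in
theorem span_D_notMem_range_col_eq_top {k B : Type*} [Field k] [CommRing B] [Algebra k B]
    {N r c : ℕ} (f : Fin r → MvPolynomial (Fin N) k) (row : Fin c ↪o Fin r) (col : Fin c ↪o Fin N)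
    (φ : MvPolynomial (Fin N) k →ₐ[k] B) (hφ : ∀ i, φ (f (row i)) = 0)
    (hdet : IsUnit (φ (jacobianSubmatrix f row col).det))
    (hspan : Submodule.span B (Set.range fun p => D k B (φ p)) = ⊤) :
    Submodule.span B (Set.range fun j' : {j' : Fin N // j' ∉ Set.range col} =>
      D k B (φ (X j'))) = ⊤ := by
  rw [eq_top_iff, ← hspan, Submodule.span_le]
  rintro _ ⟨p, rfl⟩
  have h := det_smul_derivation_apply f row col φ hφ (D k B) p
  rw [SetLike.mem_coe, ← Submodule.smul_mem_iff_of_isUnit _ hdet, h]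
  exact Submodule.sum_mem _ fun j' _ =>
    Submodule.smul_mem _ _ (Submodule.subset_span ⟨j', rfl⟩)

/-- Minimal primes of a localization contract to minimal primes q of A, and A/q embeds in B/p; the
dimension of B itself is not needed. -/
theorem le_trdeg_quotient_of_isPureDimensional {k A B : Type*} [Field k] [CommRing A] [Algebra k A]
    [Algebra.FiniteType k A] [CommRing B] [Algebra k B] [Algebra A B] [IsScalarTower k A B]
    (S : Submonoid A) [IsLocalization S B] {n : ℕ} (hdim : IsPureDimensional A n)
    {p : Ideal B} (hp : p ∈ minimalPrimes B) :
    (n : Cardinal) ≤ Algebra.trdeg k (B ⧸ p) := by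
  have hp' := hp.1.1
  have hq : p.comap (algebraMap A B) ∈ minimalPrimes A := by
    have := IsLocalization.minimalPrimes_map S B (⊥ : Ideal A)
    rw [Ideal.map_bot] at this
    exact this.le hp
  let g : (A ⧸ p.comap (algebraMap A B)) →ₐ[k] (B ⧸ p) :=
    Ideal.quotientMapₐ p (IsScalarTower.toAlgHom k A B) le_rfl
  have hg : Function.Injective g := Ideal.quotientMap_injective' (H := le_rfl) le_rfl
  have h1 := le_trdeg_of_le_ringKrullDim k _ (hdim _ hq).ge
  have h2 := lift_trdeg_le_of_injective g hg
  simpa using (Cardinal.lift_le.mpr h1).trans h2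

open KaehlerDifferential in
theorem span_D_comp_eq_top {k R A B : Type*} [CommRing k] [CommRing R] [CommRing A] [CommRing B]
    [Algebra k R] [Algebra k A] [Algebra k B] [Algebra A B] [IsScalarTower k A B]
    (S : Submonoid A) [IsLocalization S B] (φ : R →ₐ[k] A) (hφ : Function.Surjective φ) :
    Submodule.span B (Set.range fun p => D k B (algebraMap A B (φ p))) = ⊤ := by
  rw [eq_top_iff, ← span_range_map_derivation_of_isLocalization k A B S, ← hφ.range_comp]
  simp [Function.comp_def]

open KaehlerDifferential MvPolynomial in
/-- If the differentials of the coordinates outside `col` form a basis, then the derivations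
`minorDerivation f row col j'` induce a basis of the module of derivations. -/
theorem exists_basis_derivation_minorDerivation {k B : Type*} [Field k] [CommRing B] [Algebra k B]
    {N r c : ℕ} (f : Fin r → MvPolynomial (Fin N) k) (row : Fin c ↪o Fin r) (col : Fin c ↪o Fin N)
    (φ : MvPolynomial (Fin N) k →ₐ[k] B) (hφ : ∀ i, φ (f (row i)) = 0)
    (hdet : IsUnit (φ (jacobianSubmatrix f row col).det))
    (v : Module.Basis {j' : Fin N // j' ∉ Set.range col} B (KaehlerDifferential k B))
    (hv : ∀ j', v j' = D k B (φ (X j'))) :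
    ∃ b : Module.Basis {j' : Fin N // j' ∉ Set.range col} B (Derivation k B B),
      ∀ (j' : {j' : Fin N // j' ∉ Set.range col}) (p : MvPolynomial (Fin N) k),
        b j' (φ p) = φ (minorDerivation f row col j' p) := by
  classical
  let δ := v.dualBasis.map (linearMapEquivDerivation k B)
  have hδ (i j : {j' : Fin N // j' ∉ Set.range col}) :
      δ i (φ (X j)) = if i = j then 1 else 0 := by
    change v.dualBasis i (D k B (φ (X j))) = _
    rw [← hv, v.dualBasis_apply_self]
    simp [eq_comm]
  -- For E = δ_{j'} the sum in Cramer's rule collapses to one term: h·δ_{j'} is induced by D_{j'}.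
  refine ⟨δ.isUnitSMul fun _ => hdet, fun j' p => ?_⟩
  have := det_smul_derivation_apply f row col φ hφ (δ j') p
  simp_rw [hδ, smul_eq_mul, mul_ite, mul_one, mul_zero, Finset.sum_ite_eq, Finset.mem_univ,
    if_true] at this
  rw [← this, Module.Basis.isUnitSMul_apply]
  rfl

open KaehlerDifferential in
theorem Derivation.ext_of_span_D {k B ι M : Type*} [CommRing k] [CommRing B] [Algebra k B]
    [AddCommGroup M] [Module k M] [Module B M] [IsScalarTower k B M] {x : ι → B}
    (hx : Submodule.span B (Set.range fun i => D k B (x i)) = ⊤) {E F : Derivation k B M}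
    (h : ∀ i, E (x i) = F (x i)) : E = F := by
  apply (linearMapEquivDerivation k B).symm.injective
  refine LinearMap.ext_on_range hx fun i => ?_
  change E.liftKaehlerDifferential _ = F.liftKaehlerDifferential _
  simpa only [Derivation.liftKaehlerDifferential_comp_D] using h i

theorem mainTheorem5 {k : Type*} [Field k] {N r n : ℕ} (hn : n ≤ N)
    (f : Fin r → MvPolynomial (Fin N) k)
    (hsmooth : Algebra.Smooth k (CoordRing f))
    (hdim : IsPureDimensional (CoordRing f) n)
    (row : Fin (N - n) ↪o Fin r) (col : Fin (N - n) ↪o Fin N)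
    (h : MvPolynomial (Fin N) k) (hh : h = (jacobianSubmatrix f row col).det) :
    -- each `D_{j'}`, `j' ∉ col`, induces exactly one derivation of `A[h⁻¹]` over `k`
    (∀ j' : {j' : Fin N // j' ∉ Set.range col},
      ∃! D : Derivation k (CoordRingAway f h) (CoordRingAway f h),
        ∀ p : MvPolynomial (Fin N) k,
          D (toCoordRingAway f h p) = toCoordRingAway f h (minorDerivation f row col j' p)) ∧
    -- and these derivations form a basis
    (∃ b : Module.Basis {j' : Fin N // j' ∉ Set.range col} (CoordRingAway f h)
        (Derivation k (CoordRingAway f h) (CoordRingAway f h)),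
      ∀ (j' : {j' : Fin N // j' ∉ Set.range col}) (p : MvPolynomial (Fin N) k),
        b j' (toCoordRingAway f h p) =
          toCoordRingAway f h (minorDerivation f row col j' p)) := by
  classical
  let A := CoordRing f
  let B := CoordRingAway f h
  let φ : MvPolynomial (Fin N) k →ₐ[k] B :=
    (IsScalarTower.toAlgHom k A B).comp (Ideal.Quotient.mkₐ k _)
  let S := Submonoid.powers (Ideal.Quotient.mk (Ideal.span (Set.range f)) h)
  have hφ (i) : φ (f (row i)) = 0 := by
    have : Ideal.Quotient.mk (Ideal.span (Set.range f)) (f (row i)) = 0 :=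
      Ideal.Quotient.eq_zero_iff_mem.mpr (Ideal.subset_span ⟨_, rfl⟩)
    change algebraMap A B (Ideal.Quotient.mk _ (f (row i))) = 0
    rw [this, map_zero]
  have hunit : IsUnit (φ (jacobianSubmatrix f row col).det) := by
    rw [← hh]
    exact IsLocalization.Away.algebraMap_isUnit (S := B)
      (Ideal.Quotient.mk (Ideal.span (Set.range f)) h)
  have hgen : Submodule.span B (Set.range fun p => KaehlerDifferential.D k B (φ p)) = ⊤ :=
    span_D_comp_eq_top S (Ideal.Quotient.mkₐ k _) Ideal.Quotient.mk_surjective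
  have hspan := span_D_notMem_range_col_eq_top f row col φ hφ hunit hgen
  -- Formal smoothness passes to the localization, which makes Ω_{B/k} projective.
  have : Algebra.FormallySmooth A B := .of_isLocalization S
  have : Algebra.FormallySmooth k B := .comp k A B
  have hli := linearIndependent_D hspan fun p hp => by
    -- N - (N - n) = n, by `hn`.
    have hcard : Fintype.card {j' : Fin N // j' ∉ Set.range col} = n := by
      have := Fintype.sum_eq_sum_add_sum_notMem_range col.toEmbedding fun _ => (1 : ℕ)
      simp only [Finset.sum_const, Finset.card_univ, Fintype.card_fin, smul_eq_mul, mul_one,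
        RelEmbedding.coe_toEmbedding] at this
      omega
    rw [hcard]
    exact le_trdeg_quotient_of_isPureDimensional S hdim hp
  obtain ⟨b, hb⟩ := exists_basis_derivation_minorDerivation f row col φ hφ hunit
    (Module.Basis.mk hli hspan.ge) (Module.Basis.mk_apply hli hspan.ge)
  exact ⟨fun j' => ⟨b j', hb j', fun E hE =>
    Derivation.ext_of_span_D hgen fun p => (hE p).trans (hb j' p).symm⟩, b, hb⟩
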